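/- For real $b>1$ and $x$ let $$I(b,x)=\frac1{2\pi}\int_0^{2\pi}\exp\bigl(-ix\arg(1-b^{-1}e^{i\theta})\bigr)\,d\theta ,$$ where $\arg$ is the principal argument. Fix $b>1$ and put $\beta=\arcsin(1/b)$. Then $I(b,x)$ has an asymptotic expansion to all orders as $x\to+\infty$ through real values: there are real numbers $a_0,a_1,a_2,\dots$ (depending only on $b$) such that for every integer $N\ge 0$ $$I(b,x)=\sum_{k=0}^{N-1}\frac{a_k}{x^{k+1/2}}\cos\Bigl(x\beta-\frac{\pi}{4}-\frac{k\pi}{2}\Bigr)+O\bigl(x^{-N-1/2}\bigr)\qquad(x\to+\infty),$$ where the implied constant may depend on $b$ and $N$, and $$a_0=\frac{2}{\sqrt{2\pi}}(b^2-1)^{1/4},\qquad a_1=\frac{b^2+2}{4\sqrt{2\pi}}(b^2-1)^{-1/4},\qquad a_2=\frac{9b^4-28b^2+4}{64\sqrt{2\pi}}(b^2-1)^{-3/4}.$$ In particular, as $x\to+\infty$, $$\begin{aligned}I(b,x)={}&\frac{2}{\sqrt{2\pi}}\frac{(b^2-1)^{1/4}}{x^{1/2}}\cos(x\beta-\pi/4)+\frac{b^2+2}{4\sqrt{2\pi}}\frac{(b^2-1)^{-1/4}}{x^{3/2}}\sin(x\beta-\pi/4)\\&-\frac{9b^4-28b^2+4}{64\sqrt{2\pi}}\frac{(b^2-1)^{-3/4}}{x^{5/2}}\cos(x\beta-\pi/4)+O\bigl(x^{-7/2}\bigr).\end{aligned}$$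 -/

import Mathlib

/-- The function
`I(b, x) = (1 / 2π) ∫_0^{2π} exp (-i x arg (1 - b⁻¹ e^{iθ})) dθ`, with the principal argument. -/
noncomputable def charI (b x : ℝ) : ℂ :=
  (1 / (2 * (Real.pi : ℂ))) * ∫ θ in (0 : ℝ)..(2 * Real.pi),
    Complex.exp (-(Complex.I * (x : ℂ) *
      ((Complex.arg (1 - (b : ℂ)⁻¹ * Complex.exp (Complex.I * (θ : ℂ))) : ℝ) : ℂ)))

/-! With `r = 1/b` and `ψ(s) = arcsin (r sin s)`, the substitution `θ = s - ψ(s)` makes the argument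
exactly `-ψ(s)`. The `ψ'` part of `dθ` integrates to zero over a period, and symmetry leaves the
mean of `cos (x ψ)` over `[-π/2, π/2]` (`charI_eq_integral_cos`). The stationary values of `ψ` are
`±β`, interchanged by `s ↦ -s`; a cutoff whose reflection is its complement keeps only `β`, with a
factor 2.

Setting `ψ = β - v²` then makes the phase exactly quadratic. The Jacobian is a smooth function of
`v²` near the support of the cutoff, so the integral extends evenly to the whole line with a smooth
compactly supported amplitude (`charI_eq_integral_phaseAmplitude`).

Parseval turns such an integral into one of `exp (iπ²k²/x)` against a Schwartz function, and
Taylor's formula for the exponential gives every order with its error (`fresnel_expansion`). The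
coefficients are even derivatives of the amplitude at 0; the first three come from differentiating
an algebraic identity for the squared Jacobian (`phaseProfile_relations`). -/

open Filter Asymptotics MeasureTheory
open scoped FourierTransform SchwartzMap Topology ContDiff

/-! ### Fresnel integrals with Schwartz amplitude -/

/-- The Taylor remainder of the exponential is controlled by a single power on the imaginary
axis. -/
theorem norm_exp_I_mul_sub_sum_le (y : ℝ) (n : ℕ) :
    ‖Complex.exp (Complex.I * y) - ∑ m ∈ Finset.range n, (Complex.I * y) ^ m / m.factorial‖ ≤
      (Real.exp 1 + n + 1) * |y| ^ n := by
  have hn : ‖Complex.I * (y : ℂ)‖ = |y| := by simp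
  rcases le_total |y| 1 with hy | hy
  · refine (Complex.norm_exp_sub_sum_le_norm_mul_exp _ n).trans ?_
    rw [hn, mul_comm]
    gcongr
    have : Real.exp |y| ≤ Real.exp 1 := Real.exp_le_exp.2 hy
    have : (0 : ℝ) ≤ n := n.cast_nonneg
    linarith
  · have h1 : ‖∑ m ∈ Finset.range n, (Complex.I * (y : ℂ)) ^ m / (m.factorial : ℂ)‖
        ≤ n * |y| ^ n := by
      refine (norm_sum_le _ _).trans ?_
      refine (Finset.sum_le_card_nsmul _ _ (|y| ^ n) ?_).trans (by simp)
      intro m hm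
      rw [norm_div, norm_pow, hn]
      refine (div_le_self (by positivity) ?_).trans
        (pow_le_pow_right₀ hy (Finset.mem_range.1 hm).le)
      rw [Complex.norm_natCast]
      exact_mod_cast m.factorial_pos
    have h2 : 1 ≤ |y| ^ n := one_le_pow₀ hy
    have h3 : 0 ≤ Real.exp 1 * |y| ^ n := by positivity
    refine (norm_sub_le _ _).trans ?_
    rw [Complex.norm_exp_I_mul_ofReal]
    nlinarith

/-- The Fourier transform moves across the pairing onto the Gaussian, whose transform is explicit.
`0 < c.re` makes the Gaussian integrable; the purely oscillating case is a limit of this one. -/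
theorem integral_gaussian_mul_fourier (H : 𝓢(ℝ, ℂ)) {c : ℂ} (hc : 0 < c.re) :
    ∫ v : ℝ, Complex.exp (-Real.pi * c * v ^ 2) * 𝓕 (H : ℝ → ℂ) v =
      1 / c ^ (1 / 2 : ℂ) * ∫ k : ℝ, Complex.exp (-Real.pi / c * k ^ 2) * H k := by
  have hg : Integrable (fun v : ℝ => Complex.exp (-Real.pi * c * v ^ 2)) := by
    have := integrable_cexp_neg_mul_sq (b := Real.pi * c)
      (by simpa using mul_pos Real.pi_pos hc)
    simpa [neg_mul] using this
  have := VectorFourier.integral_fourierIntegral_smul_eq_flip (μ := volume) (ν := volume)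
    (L := innerₗ ℝ) (f := fun v : ℝ => Complex.exp (-Real.pi * c * v ^ 2)) (g := (H : ℝ → ℂ))
    Real.continuous_fourierChar continuous_inner hg H.integrable
  have h2 := fourier_gaussian_pi hc
  rw [flip_innerₗ] at this
  change ∫ k : ℝ, (𝓕 fun v : ℝ => Complex.exp (-Real.pi * c * v ^ 2)) k • H k = 
    ∫ v : ℝ, Complex.exp (-Real.pi * c * v ^ 2) • 𝓕 (H : ℝ → ℂ) v at this
  rw [h2] at this
  simp only [smul_eq_mul] at this
  rw [← this, ← integral_const_mul]
  simp only [mul_assoc]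

/-- Parseval's identity against the oscillating Gaussian. -/
theorem integral_exp_neg_I_mul_fourier (H : 𝓢(ℝ, ℂ)) {x : ℝ} (hx : 0 < x) :
    ∫ v : ℝ, Complex.exp (-(Complex.I * x * v ^ 2)) * 𝓕 (H : ℝ → ℂ) v =
      1 / (Complex.I * x / Real.pi) ^ (1 / 2 : ℂ) *
        ∫ k : ℝ, Complex.exp (Complex.I * ((Real.pi ^ 2 * k ^ 2 / x : ℝ) : ℂ)) * H k := by
  -- The exponent is pushed into the right half-plane by `ε > 0`, and `ε → 0⁺` is taken on both
  -- sides. The Gaussian factors have norm at most 1, so `‖𝓕 H‖` and `‖H‖` dominate.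
  set c : ℝ → ℂ := fun ε => ε + Complex.I * x / Real.pi with hc
  have hpi : (Real.pi : ℂ) ≠ 0 := by exact_mod_cast Real.pi_ne_zero
  have hx' : (x : ℂ) ≠ 0 := by exact_mod_cast hx.ne'
  have hre : ∀ ε, (c ε).re = ε := by
    intro ε
    simp [hc, Complex.div_re]
  have him : ∀ ε, (c ε).im = x / Real.pi := by
    intro ε
    have : c ε = ε + Complex.I * ((x / Real.pi : ℝ) : ℂ) := by
      simp [hc, mul_div_assoc]
    rw [this]; simp
  have hc0 : c 0 = Complex.I * x / Real.pi := by simp [hc]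
  have hcont : Continuous c := by fun_prop
  have hne : ∀ ε, c ε ≠ 0 := by
    intro ε h
    have := him ε
    rw [h] at this
    exact (div_pos hx Real.pi_pos).ne this
  have hmem : ∀ᶠ ε in 𝓝[>] (0 : ℝ), 0 < ε := self_mem_nhdsWithin
  have hF : Integrable (𝓕 (H : ℝ → ℂ)) := by
    rw [← SchwartzMap.fourier_coe]; exact (𝓕 H).integrable
  have hL : Tendsto (fun ε => ∫ v : ℝ, Complex.exp (-Real.pi * c ε * v ^ 2) * 𝓕 (H : ℝ → ℂ) v)
      (𝓝[>] 0) (𝓝 (∫ v : ℝ, Complex.exp (-Real.pi * c 0 * v ^ 2) * 𝓕 (H : ℝ → ℂ) v)) := by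
    refine tendsto_integral_filter_of_dominated_convergence (fun v => ‖𝓕 (H : ℝ → ℂ) v‖) ?_ ?_
      hF.norm ?_
    · exact Eventually.of_forall fun ε =>
        (by fun_prop : Continuous fun v : ℝ =>
          Complex.exp (-Real.pi * c ε * v ^ 2)).aestronglyMeasurable.mul hF.1
    · filter_upwards [hmem] with ε hε
      refine Eventually.of_forall fun v => ?_
      rw [norm_mul, Complex.norm_exp]
      refine mul_le_of_le_one_left (norm_nonneg _) (Real.exp_le_one_iff.2 ?_)
      have : (-(Real.pi : ℂ) * c ε * (v : ℂ) ^ 2).re = -(Real.pi * ε * v ^ 2) := by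
        rw [← Complex.ofReal_pow, Complex.re_mul_ofReal, ← Complex.ofReal_neg,
          Complex.re_ofReal_mul, hre]
        ring
      rw [this]
      have := Real.pi_pos
      have : 0 ≤ Real.pi * ε * v ^ 2 := by positivity
      linarith
    · refine Eventually.of_forall fun v => ?_
      refine Tendsto.mono_left ?_ nhdsWithin_le_nhds
      exact (by fun_prop : Continuous fun ε => Complex.exp (-Real.pi * c ε * v ^ 2) *
        𝓕 (H : ℝ → ℂ) v).tendsto 0
  have hR : Tendsto (fun ε => 1 / c ε ^ (1 / 2 : ℂ) *
      ∫ k : ℝ, Complex.exp (-Real.pi / c ε * k ^ 2) * H k)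
      (𝓝[>] 0) (𝓝 (1 / c 0 ^ (1 / 2 : ℂ) *
      ∫ k : ℝ, Complex.exp (-Real.pi / c 0 * k ^ 2) * H k)) := by
    refine Tendsto.mul ?_ ?_
    · refine Tendsto.mono_left ?_ nhdsWithin_le_nhds
      -- The limit point `c 0` lies on the positive imaginary axis, off the branch cut of the square
      -- root.
      have h1 : ContinuousAt (fun ε => c ε ^ (1 / 2 : ℂ)) 0 := by
        refine ContinuousAt.cpow hcont.continuousAt continuousAt_const ?_
        right
        rw [him]
        exact (div_pos hx Real.pi_pos).ne'
      refine (continuousAt_const.div h1 ?_).tendsto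
      rw [Complex.cpow_def_of_ne_zero (hne 0)]
      exact Complex.exp_ne_zero _
    · refine tendsto_integral_filter_of_dominated_convergence (fun v => ‖H v‖) ?_ ?_
        H.integrable.norm ?_
      · exact Eventually.of_forall fun ε =>
          (by fun_prop : Continuous fun v : ℝ =>
            Complex.exp (-Real.pi / c ε * v ^ 2)).aestronglyMeasurable.mul H.integrable.1
      · filter_upwards [hmem] with ε hε
        refine Eventually.of_forall fun v => ?_
        rw [norm_mul, Complex.norm_exp]
        refine mul_le_of_le_one_left (norm_nonneg _) (Real.exp_le_one_iff.2 ?_)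
        have : (-(Real.pi : ℂ) / c ε * (v : ℂ) ^ 2).re =
            -(Real.pi * (ε / Complex.normSq (c ε)) * v ^ 2) := by
          rw [← Complex.ofReal_pow, Complex.re_mul_ofReal, ← Complex.ofReal_neg, div_eq_mul_inv,
            Complex.re_ofReal_mul, Complex.inv_re, hre]
          ring
        rw [this]
        have := Real.pi_pos
        have := Complex.normSq_nonneg (c ε)
        have : 0 ≤ Real.pi * (ε / Complex.normSq (c ε)) * v ^ 2 := by positivity
        linarith
      · refine Eventually.of_forall fun v => ?_
        refine Tendsto.mono_left ?_ nhdsWithin_le_nhds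
        have : Continuous fun ε => Complex.exp (-Real.pi / c ε * v ^ 2) * H v := by
          have : Continuous fun ε => -Real.pi / c ε := continuous_const.div hcont hne
          fun_prop
        exact this.tendsto 0
  have heq := tendsto_nhds_unique (hL.congr' (by
    filter_upwards [hmem] with ε hε
    exact integral_gaussian_mul_fourier H (by rw [hre]; exact hε))) hR
  rw [hc0] at heq
  convert heq using 4 with v
  · congr 1
    field_simp
  · congr 2
    push_cast
    have hI : Complex.I ^ 2 = -1 := Complex.I_sq
    have hI0 := Complex.I_ne_zero
    field_simp
    rw [hI, neg_one_mul]

theorem one_div_I_mul_cpow_half {x : ℝ} (hx : 0 < x) :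
    1 / (Complex.I * x / Real.pi) ^ (1 / 2 : ℂ) =
      Real.sqrt Real.pi * Complex.exp (-(Complex.I * (Real.pi / 4))) *
        ((x ^ (-(1 / 2) : ℝ) : ℝ) : ℂ) := by
  have hy : 0 < x / Real.pi := div_pos hx Real.pi_pos
  have h1 : Complex.I * x / Real.pi = ((x / Real.pi : ℝ) : ℂ) * Complex.I := by
    push_cast; ring
  have hne : ((x / Real.pi : ℝ) : ℂ) * Complex.I ≠ 0 := by
    simp [hx.ne', Real.pi_ne_zero]
  rw [h1, Complex.cpow_def_of_ne_zero hne, Complex.log_ofReal_mul hy Complex.I_ne_zero,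
    Complex.log_I, one_div, ← Complex.exp_neg, Real.sqrt_eq_rpow, Real.rpow_def_of_pos Real.pi_pos,
    Real.rpow_def_of_pos hx, Real.log_div hx.ne' Real.pi_ne_zero]
  push_cast
  rw [← Complex.exp_add, ← Complex.exp_add]
  congr 1
  ring

theorem iteratedDeriv_fourier_zero (H : 𝓢(ℝ, ℂ)) (n : ℕ) :
    iteratedDeriv n (𝓕 (H : ℝ → ℂ)) 0 =
      ∫ k : ℝ, (-2 * Real.pi * Complex.I * k) ^ n * H k := by
  have hi : ∀ m : ℕ, (m : ℕ∞) ≤ ⊤ → Integrable (fun k : ℝ => k ^ m • H k) := by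
    intro m _
    refine (H.integrable_pow_mul volume m).mono
      (by fun_prop) (Eventually.of_forall fun k => ?_)
    simp
  rw [Real.iteratedDeriv_fourier hi le_top, Real.fourier_real_eq]
  simp

/-- The full stationary phase expansion for the phase `v ^ 2` and a Schwartz amplitude. -/
theorem fresnel_expansion (G : 𝓢(ℝ, ℂ)) (N : ℕ) :
    (fun x : ℝ => (∫ v : ℝ, Complex.exp (-(Complex.I * x * v ^ 2)) * G v) -
      ∑ k ∈ Finset.range N, Real.sqrt Real.pi * Complex.exp (-(Complex.I * (Real.pi / 4))) *
        ((-Complex.I) ^ k * iteratedDeriv (2 * k) G 0 / (4 ^ k * k.factorial)) *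
          ((x ^ (-((k : ℝ) + 1 / 2)) : ℝ) : ℂ))
      =O[atTop] fun x : ℝ => x ^ (-((N : ℝ) + 1 / 2)) := by
  obtain ⟨H, hH⟩ : ∃ H : 𝓢(ℝ, ℂ), (G : ℝ → ℂ) = 𝓕 (H : ℝ → ℂ) := by
    refine ⟨𝓕⁻ G, ?_⟩
    rw [← SchwartzMap.fourier_coe]
    simp
  have hint : ∀ m : ℕ, Integrable (fun k : ℝ => ((k : ℂ) ^ 2) ^ m * H k) := by
    intro m
    refine (H.integrable_pow_mul volume (2 * m)).mono
      (by fun_prop) (Eventually.of_forall fun k => ?_)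
    simp [pow_mul]
  set C : ℝ := (Real.exp 1 + N + 1) * ∫ k : ℝ, (Real.pi ^ 2 * k ^ 2) ^ N * ‖H k‖ with hC
  refine IsBigO.of_bound (Real.sqrt Real.pi * C) ?_
  filter_upwards [eventually_gt_atTop 0] with x hx
  have hx' : (x : ℂ) ≠ 0 := by exact_mod_cast hx.ne'
  have hpi : (Real.pi : ℂ) ≠ 0 := by exact_mod_cast Real.pi_ne_zero
  -- Even moments of `H` are even derivatives of `G = 𝓕 H` at 0: each pair of derivatives brings
  -- down `(-2πik)² = -4π²k²`, which accounts for `(-i)^k / 4^k`.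
  have hcoef : ∀ k : ℕ, ∫ t : ℝ, (Complex.I * ((Real.pi ^ 2 * t ^ 2 / x : ℝ) : ℂ)) ^ k /
      k.factorial * H t = (-Complex.I) ^ k * iteratedDeriv (2 * k) G 0 / (4 ^ k * k.factorial) *
        ((x ^ (-(k : ℝ)) : ℝ) : ℂ) := by
    intro k
    rw [hH, iteratedDeriv_fourier_zero, ← integral_const_mul, ← integral_div, ← integral_mul_const]
    congr 1
    ext t
    rw [Real.rpow_neg hx.le, Real.rpow_natCast, pow_mul]
    push_cast
    have h2 : (-2 * (Real.pi : ℂ) * Complex.I * t) ^ 2 = -(4 * (Real.pi ^ 2 * t ^ 2)) := by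
      linear_combination 4 * (Real.pi : ℂ) ^ 2 * (t : ℂ) ^ 2 * Complex.I_sq
    rw [h2, mul_pow, div_pow]
    have h3 : (-Complex.I) ^ k * (-(4 * ((Real.pi : ℂ) ^ 2 * t ^ 2))) ^ k =
        4 ^ k * (Complex.I ^ k * (Real.pi ^ 2 * t ^ 2) ^ k) := by
      rw [← mul_pow, ← mul_pow, ← mul_pow]; ring
    rw [← mul_assoc, h3]
    have : (4 : ℂ) ^ k ≠ 0 := pow_ne_zero _ (by norm_num)
    field_simp
  have hmain : ‖(∫ k : ℝ, Complex.exp (Complex.I * ((Real.pi ^ 2 * k ^ 2 / x : ℝ) : ℂ)) * H k) -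
      ∑ k ∈ Finset.range N, (-Complex.I) ^ k * iteratedDeriv (2 * k) G 0 / (4 ^ k * k.factorial) *
        ((x ^ (-(k : ℝ)) : ℝ) : ℂ)‖ ≤ C * x ^ (-(N : ℝ)) := by
    simp_rw [← hcoef]
    rw [← integral_finsetSum, ← integral_sub]
    · rw [hC, mul_assoc, ← integral_mul_const, ← integral_const_mul]
      refine norm_integral_le_of_norm_le ?_ (Eventually.of_forall fun k => ?_)
      · refine Integrable.const_mul (Integrable.mul_const ?_ _) _
        refine ((hint N).norm.const_mul ((Real.pi ^ 2) ^ N)).congr (Eventually.of_forall fun k => ?_)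
        simp [mul_pow, mul_assoc]
      · rw [← Finset.sum_mul, ← sub_mul, norm_mul]
        refine (mul_le_mul_of_nonneg_right (norm_exp_I_mul_sub_sum_le _ N) (norm_nonneg _)).trans
          (le_of_eq ?_)
        rw [abs_of_nonneg (by positivity), Real.rpow_neg hx.le, Real.rpow_natCast, div_pow]
        ring
    · refine H.integrable.norm.mono (by fun_prop) (Eventually.of_forall fun k => ?_)
      rw [norm_mul, Complex.norm_exp_I_mul_ofReal]
      simp
    · refine integrable_finsetSum _ fun m _ => ?_
      refine ((hint m).const_mul ((Complex.I * (Real.pi ^ 2 / x)) ^ m / m.factorial)).congr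
        (Eventually.of_forall fun k => ?_)
      push_cast
      simp only [mul_pow, div_pow]
      ring
    · intro m _
      refine ((hint m).const_mul ((Complex.I * (Real.pi ^ 2 / x)) ^ m / m.factorial)).congr
        (Eventually.of_forall fun k => ?_)
      push_cast
      simp only [mul_pow, div_pow]
      ring
  have hsplit : ∀ k : ℕ, x ^ (-((k : ℝ) + 1 / 2)) = x ^ (-(1 / 2) : ℝ) * x ^ (-(k : ℝ)) := by
    intro k
    rw [← Real.rpow_add hx]; congr 1; ring
  have hfac : (∫ v : ℝ, Complex.exp (-(Complex.I * x * v ^ 2)) * G v) -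
      ∑ k ∈ Finset.range N, Real.sqrt Real.pi * Complex.exp (-(Complex.I * (Real.pi / 4))) *
        ((-Complex.I) ^ k * iteratedDeriv (2 * k) G 0 / (4 ^ k * k.factorial)) *
          ((x ^ (-((k : ℝ) + 1 / 2)) : ℝ) : ℂ) =
      Real.sqrt Real.pi * Complex.exp (-(Complex.I * (Real.pi / 4))) *
        ((x ^ (-(1 / 2) : ℝ) : ℝ) : ℂ) *
      ((∫ k : ℝ, Complex.exp (Complex.I * ((Real.pi ^ 2 * k ^ 2 / x : ℝ) : ℂ)) * H k) -
      ∑ k ∈ Finset.range N, (-Complex.I) ^ k * iteratedDeriv (2 * k) G 0 / (4 ^ k * k.factorial) *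
        ((x ^ (-(k : ℝ)) : ℝ) : ℂ)) := by
    rw [mul_sub, Finset.mul_sum, ← one_div_I_mul_cpow_half hx,
      ← integral_exp_neg_I_mul_fourier H hx, ← hH, one_div_I_mul_cpow_half hx]
    congr 1
    refine Finset.sum_congr rfl fun k _ => ?_
    rw [hsplit]
    push_cast
    ring
  rw [hfac, norm_mul, norm_mul, norm_mul, hsplit, norm_mul]
  have he : ‖Complex.exp (-(Complex.I * ((Real.pi : ℂ) / 4)))‖ = 1 := by
    have : -(Complex.I * ((Real.pi : ℂ) / 4)) = Complex.I * ((-(Real.pi / 4) : ℝ) : ℂ) := by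
      push_cast; ring
    rw [this, Complex.norm_exp_I_mul_ofReal]
  rw [he, Complex.norm_real, Complex.norm_real, Real.norm_of_nonneg (Real.sqrt_nonneg _),
    mul_one, Real.norm_of_nonneg (Real.rpow_nonneg hx.le (-(N : ℝ)))]
  calc _ ≤ Real.sqrt Real.pi * ‖x ^ (-(1 / 2) : ℝ)‖ * (C * x ^ (-(N : ℝ))) := by gcongr
    _ = _ := by ring

/-! ### Smoothness and Taylor data of `sinc` -/

namespace Real

theorem contDiff_sinc : ContDiff ℝ ∞ sinc := by
  rw [contDiff_iff_contDiffAt]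
  intro x
  rcases eq_or_ne x 0 with rfl | hx
  · obtain ⟨p, hp⟩ := (analyticAt_sin : AnalyticAt ℝ sin 0)
    rw [sinc_eq_dslope]
    exact (AnalyticAt.contDiffAt ⟨_, hp.has_fpower_series_dslope_fslope⟩)
  · have h : sinc =ᶠ[𝓝 x] fun y => sin y / y := by
      filter_upwards [isOpen_ne.mem_nhds hx] with y hy
      exact sinc_of_ne_zero hy
    exact (contDiff_sin.contDiffAt.div contDiffAt_id hx).congr_of_eventuallyEq h

theorem mul_sinc (x : ℝ) : x * sinc x = sin x := by
  rcases eq_or_ne x 0 with rfl | hx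
  · simp
  · rw [sinc_of_ne_zero hx]; field_simp

theorem sinc_pos {x : ℝ} (h1 : -π < x) (h2 : x < π) : 0 < sinc x := by
  rcases lt_trichotomy x 0 with hx | rfl | hx
  · rw [sinc_of_ne_zero hx.ne]
    exact div_pos_of_neg_of_neg (sin_neg_of_neg_of_neg_pi_lt hx h1) hx
  · simp
  · rw [sinc_of_ne_zero hx.ne']
    exact div_pos (sin_pos_of_pos_of_lt_pi hx h2) hx

theorem contDiff_deriv_sinc : ContDiff ℝ ∞ (deriv sinc) :=
  contDiff_infty_iff_deriv.1 contDiff_sinc |>.2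

theorem hasDerivAt_sinc (x : ℝ) : HasDerivAt sinc (deriv sinc x) x :=
  (contDiff_sinc.differentiable (by simp)).differentiableAt.hasDerivAt

theorem hasDerivAt_deriv_sinc (x : ℝ) : HasDerivAt (deriv sinc) (deriv (deriv sinc) x) x :=
  (contDiff_deriv_sinc.differentiable (by simp)).differentiableAt.hasDerivAt

/-- Differentiating `x * sinc x = sin x` gives relations free of division, so repeated
differentiation and evaluation at 0 yield the Taylor coefficients of `sinc`. -/
theorem sinc_add_mul_deriv_sinc (x : ℝ) : sinc x + x * deriv sinc x = cos x := by
  have h1 := (hasDerivAt_id x).mul (hasDerivAt_sinc x)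
  have h2 : HasDerivAt (id * sinc) (cos x) x := by
    convert hasDerivAt_sin x using 1
    ext y; exact mul_sinc y
  simpa using h1.unique h2

theorem two_mul_deriv_sinc_add (x : ℝ) :
    2 * deriv sinc x + x * deriv (deriv sinc) x = -sin x := by
  have h1 := (hasDerivAt_sinc x).add ((hasDerivAt_id x).mul (hasDerivAt_deriv_sinc x))
  have h2 : HasDerivAt (sinc + id * deriv sinc) (-sin x) x := by
    convert hasDerivAt_cos x using 1
    ext y; exact sinc_add_mul_deriv_sinc y
  have := h1.unique h2
  simp at this
  linarith

theorem deriv_sinc_zero : deriv sinc 0 = 0 := by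
  simpa using two_mul_deriv_sinc_add 0

theorem deriv_deriv_sinc_zero : deriv (deriv sinc) 0 = -1 / 3 := by
  have hs : HasDerivAt (deriv (deriv sinc)) (deriv (deriv (deriv sinc)) 0) 0 :=
    ((contDiff_infty_iff_deriv.1 contDiff_deriv_sinc).2.differentiable
      (by simp)).differentiableAt.hasDerivAt
  have h1 := ((hasDerivAt_deriv_sinc 0).const_mul 2).add ((hasDerivAt_id (0 : ℝ)).mul hs)
  have h2 : HasDerivAt ((fun x => 2 * deriv sinc x) + id * deriv (deriv sinc)) (-cos 0) 0 := by
    rw [show (fun x => 2 * deriv sinc x) + id * deriv (deriv sinc) = -sin from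
      funext two_mul_deriv_sinc_add]
    exact (hasDerivAt_sin 0).neg
  have := h1.unique h2
  simp at this
  linarith

end Real

/-- Derivatives at the origin of `v ↦ g (v ^ 2)`. -/
theorem iteratedDeriv_comp_sq_zero {g : ℝ → ℝ} {U : Set ℝ} (hU : IsOpen U) (h0 : (0 : ℝ) ∈ U)
    (hg : ContDiffOn ℝ ∞ g U) :
    iteratedDeriv 2 (fun v => g (v ^ 2)) 0 = 2 * deriv g 0 ∧
      iteratedDeriv 4 (fun v => g (v ^ 2)) 0 = 12 * deriv (deriv g) 0 := by
  have hg1 : ContDiffOn ℝ ∞ (deriv g) U := hg.deriv_of_isOpen hU (by simp)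
  have hg2 : ContDiffOn ℝ ∞ (deriv (deriv g)) U := hg1.deriv_of_isOpen hU (by simp)
  have hg3 : ContDiffOn ℝ ∞ (deriv (deriv (deriv g))) U := hg2.deriv_of_isOpen hU (by simp)
  have key : ∀ {f : ℝ → ℝ}, ContDiffOn ℝ ∞ f U → ∀ v : ℝ, v ^ 2 ∈ U →
      HasDerivAt (fun v => f (v ^ 2)) (deriv f (v ^ 2) * (2 * v)) v := by
    intro f hf v hv
    have h1 : HasDerivAt f (deriv f (v ^ 2)) (v ^ 2) :=
      ((hf.contDiffAt (hU.mem_nhds hv)).differentiableAt (by simp)).hasDerivAt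
    simpa using! HasDerivAt.comp (h := fun v : ℝ => v ^ 2) v h1 (hasDerivAt_pow 2 v)
  -- `g` is smooth only on `U`, so the derivative formulas are identities of germs at 0.
  have hev : ∀ᶠ v : ℝ in 𝓝 0, v ^ 2 ∈ U :=
    (continuous_pow 2).continuousAt.eventually (hU.mem_nhds (by simpa using h0))
  have e1 : deriv (fun v => g (v ^ 2)) =ᶠ[𝓝 0] fun v => deriv g (v ^ 2) * (2 * v) :=
    hev.mono fun v hv => (key hg v hv).deriv
  have e2 : deriv (deriv fun v => g (v ^ 2)) =ᶠ[𝓝 0]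
      fun v => deriv (deriv g) (v ^ 2) * (4 * v ^ 2) + deriv g (v ^ 2) * 2 := by
    refine e1.deriv.trans (hev.mono fun v hv => ?_)
    have := (key hg1 v hv).mul ((hasDerivAt_id v).const_mul 2)
    refine (HasDerivAt.deriv this).trans ?_
    simp only [id]; ring
  have e3 : deriv (deriv (deriv fun v => g (v ^ 2))) =ᶠ[𝓝 0]
      fun v => deriv (deriv (deriv g)) (v ^ 2) * (8 * v ^ 3) +
        deriv (deriv g) (v ^ 2) * (12 * v) := by
    refine e2.deriv.trans (hev.mono fun v hv => ?_)
    have := ((key hg2 v hv).mul ((hasDerivAt_pow 2 v).const_mul 4)).add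
      ((key hg1 v hv).mul_const 2)
    refine (HasDerivAt.deriv this).trans ?_
    simp; ring
  constructor
  · rw [iteratedDeriv_succ, iteratedDeriv_one, e2.eq_of_nhds]
    simp [mul_comm]
  · rw [iteratedDeriv_succ, iteratedDeriv_succ, iteratedDeriv_succ, iteratedDeriv_one,
      e3.deriv_eq]
    have h0' : (0 : ℝ) ^ 2 ∈ U := by simpa using h0
    have := ((key hg3 0 h0').mul ((hasDerivAt_pow 3 (0 : ℝ)).const_mul 8)).add
      ((key hg2 0 h0').mul ((hasDerivAt_id (0 : ℝ)).const_mul 12))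
    refine (HasDerivAt.deriv this).trans ?_
    simp [mul_comm]

/-! ### Profile, cutoff and amplitude -/

/-- The density of the phase variable near the stationary point, regularised by the factor
`√w`. -/
noncomputable def phaseProfile (β w : ℝ) : ℝ :=
  2 * Real.cos (β - w) / √(Real.sin (2 * β - w) * Real.sinc w)

/-- The smooth cutoff of the phase variable; its reflection is its complement. -/
noncomputable def phaseCutoff (β y : ℝ) : ℝ := Real.smoothTransition (1 / 2 + y / β)

/-- The amplitude in the coordinate `v` in which the phase is `β - v ^ 2`. -/
noncomputable def phaseAmplitude (β v : ℝ) : ℝ :=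
  phaseCutoff β (β - v ^ 2) * phaseProfile β (v ^ 2)

theorem sin_mul_sinc_pos {β w : ℝ} (h0 : 0 < β) (h1 : β < Real.pi / 2)
    (hw : w ∈ Set.Ioo (2 * β - Real.pi) (2 * β)) :
    0 < Real.sin (2 * β - w) * Real.sinc w := by
  obtain ⟨ha, hb⟩ := hw
  exact mul_pos (Real.sin_pos_of_pos_of_lt_pi (by linarith) (by linarith))
    (Real.sinc_pos (by linarith) (by linarith))

theorem contDiffOn_phaseProfile {β : ℝ} (h0 : 0 < β) (h1 : β < Real.pi / 2) :
    ContDiffOn ℝ ∞ (phaseProfile β) (Set.Ioo (2 * β - Real.pi) (2 * β)) := by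
  intro w hw
  have hpos := sin_mul_sinc_pos h0 h1 hw
  refine ContDiffAt.contDiffWithinAt ?_
  unfold phaseProfile
  refine ContDiffAt.div (by fun_prop) (ContDiffAt.sqrt ?_ hpos.ne') (Real.sqrt_pos.2 hpos).ne'
  exact ContDiffAt.mul (by fun_prop) Real.contDiff_sinc.contDiffAt

theorem contDiff_phaseCutoff (β : ℝ) : ContDiff ℝ ∞ (phaseCutoff β) :=
  Real.smoothTransition.contDiff.comp (by fun_prop)

theorem phaseCutoff_add_neg (β y : ℝ) : phaseCutoff β y + phaseCutoff β (-y) = 1 := by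
  unfold phaseCutoff Real.smoothTransition
  have h := Real.smoothTransition.pos_denom (1 / 2 + y / β)
  have e : (1 : ℝ) / 2 + -y / β = 1 - (1 / 2 + y / β) := by ring
  rw [e, sub_sub_cancel, add_comm (expNegInvGlue (1 - _)), ← add_div, div_self h.ne']

/-- The cutoff dies well before the other stationary value `-β`, which corresponds to `w = 2β`,
where the denominator of the profile vanishes. -/
theorem phaseCutoff_eq_zero {β y : ℝ} (h0 : 0 < β) (hy : y ≤ -β / 2) : phaseCutoff β y = 0 := by
  refine Real.smoothTransition.zero_of_nonpos ?_
  have : y / β ≤ -1 / 2 := by rw [div_le_iff₀ h0]; linarith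
  linarith

theorem phaseCutoff_eq_one {β y : ℝ} (h0 : 0 < β) (hy : β / 2 ≤ y) : phaseCutoff β y = 1 := by
  refine Real.smoothTransition.one_of_one_le ?_
  have : 1 / 2 ≤ y / β := by rw [le_div_iff₀ h0]; linarith
  linarith

theorem phaseAmplitude_eq_zero {β v : ℝ} (h0 : 0 < β) (hv : 3 * β / 2 ≤ v ^ 2) :
    phaseAmplitude β v = 0 := by
  rw [phaseAmplitude, phaseCutoff_eq_zero h0 (by linarith), zero_mul]

/-- The profile is smooth for `0 ≤ v² < 2β`, and the amplitude already vanishes from `v² = 3β/2` on;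
these two regions overlap. -/
theorem contDiff_phaseAmplitude {β : ℝ} (h0 : 0 < β) (h1 : β < Real.pi / 2) :
    ContDiff ℝ ∞ (phaseAmplitude β) := by
  rw [contDiff_iff_contDiffAt]
  intro v
  rcases lt_or_ge (v ^ 2) (2 * β) with hv | hv
  · refine ContDiffAt.mul ((contDiff_phaseCutoff β).comp (by fun_prop)).contDiffAt ?_
    have : ContDiffAt ℝ ∞ (phaseProfile β) (v ^ 2) :=
      (contDiffOn_phaseProfile h0 h1).contDiffAt
        (isOpen_Ioo.mem_nhds ⟨by nlinarith [sq_nonneg v], hv⟩)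
    exact ContDiffAt.comp (f := fun v : ℝ => v ^ 2) v this (by fun_prop)
  · have : phaseAmplitude β =ᶠ[𝓝 v] fun _ => 0 := by
      have : ∀ᶠ u : ℝ in 𝓝 v, 3 * β / 2 < u ^ 2 :=
        (continuous_pow 2).continuousAt.eventually (lt_mem_nhds (by linarith))
      exact this.mono fun u hu => phaseAmplitude_eq_zero h0 hu.le
    exact contDiffAt_const.congr_of_eventuallyEq this

theorem hasCompactSupport_phaseAmplitude {β : ℝ} (h0 : 0 < β) :
    HasCompactSupport (phaseAmplitude β) := by
  refine HasCompactSupport.intro (isCompact_Icc (a := -√(2 * β)) (b := √(2 * β))) fun v hv => ?_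
  refine phaseAmplitude_eq_zero h0 ?_
  by_contra! h
  exact hv (abs_le.1 (Real.abs_le_sqrt (by linarith)))

theorem phaseAmplitude_eventuallyEq {β : ℝ} (h0 : 0 < β) :
    phaseAmplitude β =ᶠ[𝓝 0] fun v => phaseProfile β (v ^ 2) := by
  have : ∀ᶠ u : ℝ in 𝓝 0, u ^ 2 < β / 2 :=
    (continuous_pow 2).continuousAt.eventually (gt_mem_nhds (by simpa using h0))
  refine this.mono fun u hu => ?_
  rw [phaseAmplitude, phaseCutoff_eq_one h0 (by linarith), one_mul]

theorem iteratedDeriv_phaseAmplitude_zero {β : ℝ} (h0 : 0 < β) (h1 : β < Real.pi / 2) :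
    iteratedDeriv 0 (phaseAmplitude β) 0 = phaseProfile β 0 ∧
    iteratedDeriv 2 (phaseAmplitude β) 0 = 2 * deriv (phaseProfile β) 0 ∧
      iteratedDeriv 4 (phaseAmplitude β) 0 = 12 * deriv (deriv (phaseProfile β)) 0 := by
  have hm : (0 : ℝ) ∈ Set.Ioo (2 * β - Real.pi) (2 * β) := ⟨by linarith, by linarith⟩
  have := iteratedDeriv_comp_sq_zero isOpen_Ioo hm (contDiffOn_phaseProfile h0 h1)
  have he := phaseAmplitude_eventuallyEq h0
  refine ⟨by simpa using he.eq_of_nhds, ?_, ?_⟩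
  · rw [he.iteratedDeriv_eq]; exact this.1
  · rw [he.iteratedDeriv_eq]; exact this.2

/-- The algebraic relations satisfied by the Taylor coefficients of the profile. -/
theorem phaseProfile_relations {β : ℝ} (h0 : 0 < β) (h1 : β < Real.pi / 2) :
    2 * phaseProfile β 0 * deriv (phaseProfile β) 0 * Real.sin (2 * β) -
        phaseProfile β 0 ^ 2 * Real.cos (2 * β) = 8 * Real.cos β * Real.sin β ∧
    (2 * deriv (phaseProfile β) 0 ^ 2 + 2 * phaseProfile β 0 * deriv (deriv (phaseProfile β)) 0) *
        Real.sin (2 * β) - 4 * phaseProfile β 0 * deriv (phaseProfile β) 0 * Real.cos (2 * β) -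
        phaseProfile β 0 ^ 2 * (4 / 3 * Real.sin (2 * β)) =
      8 * (Real.sin β ^ 2 - Real.cos β ^ 2) := by
  set U := Set.Ioo (2 * β - Real.pi) (2 * β) with hU
  have hUo : IsOpen U := isOpen_Ioo
  have hm : (0 : ℝ) ∈ U := ⟨by linarith, by linarith⟩
  set p := phaseProfile β with hp
  have hC : ContDiffOn ℝ ∞ p U := contDiffOn_phaseProfile h0 h1
  have hC1 : ContDiffOn ℝ ∞ (deriv p) U := hC.deriv_of_isOpen hUo (by simp)
  have d0 : ∀ w ∈ U, HasDerivAt p (deriv p w) w := fun w hw =>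
    ((hC.contDiffAt (hUo.mem_nhds hw)).differentiableAt (by simp)).hasDerivAt
  have d1 : ∀ w ∈ U, HasDerivAt (deriv p) (deriv (deriv p) w) w := fun w hw =>
    ((hC1.contDiffAt (hUo.mem_nhds hw)).differentiableAt (by simp)).hasDerivAt
  have ds : ∀ w, HasDerivAt (fun w => Real.sin (2 * β - w)) (-Real.cos (2 * β - w)) w := by
    intro w
    simpa using ((hasDerivAt_id w).const_sub (2 * β)).sin
  have dc : ∀ w, HasDerivAt (fun w => Real.cos (2 * β - w)) (Real.sin (2 * β - w)) w := by
    intro w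
    simpa using ((hasDerivAt_id w).const_sub (2 * β)).cos
  have ds' : ∀ w, HasDerivAt (fun w => Real.sin (β - w)) (-Real.cos (β - w)) w := by
    intro w
    simpa using ((hasDerivAt_id w).const_sub β).sin
  have dc' : ∀ w, HasDerivAt (fun w => Real.cos (β - w)) (Real.sin (β - w)) w := by
    intro w
    simpa using ((hasDerivAt_id w).const_sub β).cos
  -- Squaring removes the root from the profile. Differentiating this identity once and twice at 0
  -- gives the two relations, linear in the highest derivative.
  have e0 : ∀ w ∈ U, p w ^ 2 * (Real.sin (2 * β - w) * Real.sinc w) = 4 * Real.cos (β - w) ^ 2 := by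
    intro w hw
    have hpos := sin_mul_sinc_pos h0 h1 hw
    rw [hp, phaseProfile, div_pow, Real.sq_sqrt hpos.le, div_mul_cancel₀ _ hpos.ne']
    ring
  have e1 : ∀ w ∈ U, 2 * p w * deriv p w * (Real.sin (2 * β - w) * Real.sinc w) +
      p w ^ 2 * (-Real.cos (2 * β - w) * Real.sinc w + Real.sin (2 * β - w) * deriv Real.sinc w) =
      8 * Real.cos (β - w) * Real.sin (β - w) := by
    intro w hw
    have a := ((d0 w hw).pow 2).mul ((ds w).mul (Real.hasDerivAt_sinc w))
    have b := ((dc' w).pow 2).const_mul 4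
    have := a.unique (b.congr_of_eventuallyEq ((hUo.eventually_mem hw).mono e0))
    simp at this
    linarith
  have e2 : HasDerivAt (fun w => 2 * p w * deriv p w * (Real.sin (2 * β - w) * Real.sinc w) +
      p w ^ 2 * (-Real.cos (2 * β - w) * Real.sinc w + Real.sin (2 * β - w) * deriv Real.sinc w))
      _ 0 :=
    ((((d0 0 hm).const_mul 2).mul (d1 0 hm)).mul ((ds 0).mul (Real.hasDerivAt_sinc 0))).add
    (((d0 0 hm).pow 2).mul (((dc 0).neg.mul (Real.hasDerivAt_sinc 0)).add
      ((ds 0).mul (Real.hasDerivAt_deriv_sinc 0))))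
  have e3 := e2.unique ((((dc' 0).const_mul 8).mul (ds' 0)).congr_of_eventuallyEq
    ((hUo.eventually_mem hm).mono e1))
  refine ⟨?_, ?_⟩
  · have := e1 0 hm
    simp [Real.deriv_sinc_zero] at this
    linarith
  · simp [Real.deriv_sinc_zero, Real.deriv_deriv_sinc_zero] at e3
    linarith

/-! ### Reduction to a real cosine integral -/

theorem mul_sin_sq_lt_one {r : ℝ} (hr0 : 0 < r) (hr1 : r < 1) (s : ℝ) :
    (r * Real.sin s) ^ 2 < 1 := by
  have h1 := Real.sin_sq_le_one s
  have h2 : r ^ 2 < 1 := by nlinarith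
  rw [mul_pow]
  nlinarith [sq_nonneg (Real.sin s), sq_nonneg r]

theorem hasDerivAt_arcsin_mul_sin {r : ℝ} (hr0 : 0 < r) (hr1 : r < 1) (s : ℝ) :
    HasDerivAt (fun s => Real.arcsin (r * Real.sin s))
      (1 / √(1 - (r * Real.sin s) ^ 2) * (r * Real.cos s)) s := by
  have h := mul_sin_sq_lt_one hr0 hr1 s
  refine (Real.hasDerivAt_arcsin ?_ ?_).comp s ((Real.hasDerivAt_sin s).const_mul r)
  · intro e; rw [e] at h; norm_num at h
  · intro e; rw [e] at h; norm_num at h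

/-- The argument of `1 - r e^{iθ}` at `θ = s - arcsin (r sin s)`. -/
theorem arg_one_sub_mul_exp {r : ℝ} (hr0 : 0 < r) (hr1 : r < 1) (s : ℝ) :
    Complex.arg (1 - (r : ℂ) * Complex.exp
      (Complex.I * ((s - Real.arcsin (r * Real.sin s) : ℝ) : ℂ))) =
      -Real.arcsin (r * Real.sin s) := by
  have h := mul_sin_sq_lt_one hr0 hr1 s
  obtain ⟨ha, hb⟩ := abs_lt.1 ((sq_lt_one_iff_abs_lt_one _).1 h)
  set ψ := Real.arcsin (r * Real.sin s) with hψ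
  have hsin : Real.sin ψ = r * Real.sin s := Real.sin_arcsin ha.le hb.le
  have hcos : 0 ≤ Real.cos ψ := Real.cos_arcsin_nonneg _
  have hcs := Real.sin_sq_add_cos_sq ψ
  have hcs' := Real.sin_sq_add_cos_sq s
  -- Since `sin ψ = r sin s`, one has `1 - r e^{i(s-ψ)} = (cos ψ - r cos s) e^{-iψ}`; it remains to
  -- see that this real factor is positive.
  have hρ : 0 < Real.cos ψ - r * Real.cos s := by
    rw [sub_pos]
    refine lt_of_pow_lt_pow_left₀ 2 hcos ?_
    have : r ^ 2 < 1 := by nlinarith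
    have e : Real.cos ψ ^ 2 = 1 - r ^ 2 * Real.sin s ^ 2 := by rw [hsin] at hcs; linarith
    rw [e, mul_pow]
    nlinarith
  have hmem : -ψ ∈ Set.Ioc (-Real.pi) Real.pi := by
    have := Real.neg_pi_div_two_le_arcsin (r * Real.sin s)
    have := Real.arcsin_le_pi_div_two (r * Real.sin s)
    have := Real.pi_pos
    constructor <;> linarith
  rw [← Complex.arg_mul_cos_add_sin_mul_I hρ hmem]
  congr 1
  rw [mul_comm Complex.I, Complex.exp_mul_I, ← Complex.ofReal_cos, ← Complex.ofReal_sin,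
    ← Complex.ofReal_cos, ← Complex.ofReal_sin, Real.cos_neg, Real.sin_neg, Real.cos_sub,
    Real.sin_sub, hsin]
  apply Complex.ext
  · simp [-Complex.ofReal_cos, -Complex.ofReal_sin]
    rw [hsin] at hcs
    linear_combination -hcs
  · simp [-Complex.ofReal_cos, -Complex.ofReal_sin]
    ring

/-- Under `θ = s - ψ(s)` the weight is `1 - ψ'`. The term `ψ' e^{ixψ}` is an exact derivative, and
`ψ` vanishes at both endpoints, so only the weight 1 survives. -/
theorem charI_eq_integral_arcsin {b : ℝ} (hb : 1 < b) (x : ℝ) :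
    charI b x = 1 / (2 * (Real.pi : ℂ)) * ∫ s in (0 : ℝ)..(2 * Real.pi),
      Complex.exp (Complex.I * ((x * Real.arcsin (b⁻¹ * Real.sin s) : ℝ) : ℂ)) := by
  have hr0 : 0 < b⁻¹ := by positivity
  have hr1 : b⁻¹ < 1 := inv_lt_one_of_one_lt₀ hb
  set r := b⁻¹ with hr
  set ψ : ℝ → ℝ := fun s => Real.arcsin (r * Real.sin s) with hψ
  set ψ' : ℝ → ℝ := fun s => 1 / √(1 - (r * Real.sin s) ^ 2) * (r * Real.cos s) with hψ'
  have hd : ∀ s, HasDerivAt ψ (ψ' s) s := hasDerivAt_arcsin_mul_sin hr0 hr1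
  have hψc : Continuous ψ := continuous_iff_continuousAt.2 fun s => (hd s).continuousAt
  have hψ'c : Continuous ψ' := by
    refine Continuous.mul (continuous_const.div (by fun_prop) fun s => ?_) (by fun_prop)
    exact (Real.sqrt_pos.2 (sub_pos.2 (mul_sin_sq_lt_one hr0 hr1 s))).ne'
  set f : ℝ → ℂ := fun θ => Complex.exp (-(Complex.I * (x : ℂ) *
      ((Complex.arg (1 - (b : ℂ)⁻¹ * Complex.exp (Complex.I * (θ : ℂ))) : ℝ) : ℂ))) with hf
  set e : ℝ → ℂ := fun y => Complex.exp (Complex.I * ((x * y : ℝ) : ℂ)) with he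
  have hec : Continuous e := by fun_prop
  have hfc : Continuous f := by
    have : Continuous fun θ : ℝ =>
        Complex.arg (1 - (b : ℂ)⁻¹ * Complex.exp (Complex.I * (θ : ℂ))) := by
      rw [continuous_iff_continuousAt]
      intro θ
      refine ContinuousAt.comp (g := Complex.arg) (Complex.continuousAt_arg ?_) (by fun_prop)
      left
      have h1 : ‖(b : ℂ)⁻¹ * Complex.exp (Complex.I * (θ : ℂ))‖ = r := by
        rw [norm_mul, Complex.norm_exp_I_mul_ofReal, norm_inv, Complex.norm_real,
          Real.norm_of_nonneg (by linarith), mul_one]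
      have h2 := Complex.re_le_norm ((b : ℂ)⁻¹ * Complex.exp (Complex.I * (θ : ℂ)))
      rw [Complex.sub_re, Complex.one_re]
      linarith
    fun_prop
  have hfe : ∀ s, f (s - ψ s) = e (ψ s) := by
    intro s
    have := arg_one_sub_mul_exp hr0 hr1 s
    rw [hr, Complex.ofReal_inv, ← hr] at this
    simp only [hf, he, hψ]
    rw [this]
    congr 1
    push_cast
    ring
  have h1 := intervalIntegral.integral_deriv_smul_comp (a := 0) (b := 2 * Real.pi)
    (f := fun s => s - ψ s) (f' := fun s => 1 - ψ' s) (g := f)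
    (fun s _ => (hasDerivAt_id s).sub (hd s)) (by fun_prop) hfc
  have h2 := intervalIntegral.integral_deriv_smul_comp (a := 0) (b := 2 * Real.pi)
    (f := ψ) (f' := ψ') (g := e) (fun s _ => hd s) (by fun_prop) hec
  have hψ0 : ψ 0 = 0 := by simp [hψ]
  have hψ2 : ψ (2 * Real.pi) = 0 := by simp [hψ]
  simp only [Function.comp, hψ0, hψ2, intervalIntegral.integral_same, sub_zero, hfe, sub_smul,
    one_smul] at h1 h2
  have i1 : Continuous fun s => e (ψ s) := hec.comp hψc
  have i2 : Continuous fun s => ψ' s • e (ψ s) := hψ'c.smul i1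
  rw [intervalIntegral.integral_sub (i1.intervalIntegrable _ _) (i2.intervalIntegrable _ _), h2,
    sub_zero] at h1
  rw [charI, ← h1]

/-- The reflection `s ↦ π - s` folds the period in half, and `s ↦ -s`, under which the phase is odd,
leaves the cosine. -/
theorem charI_eq_integral_cos {b : ℝ} (hb : 1 < b) (x : ℝ) :
    charI b x = ((1 / Real.pi * ∫ s in (-(Real.pi / 2))..(Real.pi / 2),
      Real.cos (x * Real.arcsin (b⁻¹ * Real.sin s)) : ℝ) : ℂ) := by
  have hr0 : 0 < b⁻¹ := by positivity
  have hr1 : b⁻¹ < 1 := inv_lt_one_of_one_lt₀ hb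
  set F : ℝ → ℂ := fun s =>
    Complex.exp (Complex.I * ((x * Real.arcsin (b⁻¹ * Real.sin s) : ℝ) : ℂ)) with hF
  have hFc : Continuous F := by
    have := Real.continuous_arcsin
    fun_prop
  have hi : ∀ a c, IntervalIntegrable F volume a c := fun a c => hFc.intervalIntegrable a c
  have hper : Function.Periodic F (2 * Real.pi) := fun s => by simp [hF, Real.sin_add_two_pi]
  have h1 : ∫ s in (0 : ℝ)..(2 * Real.pi), F s =
      2 * ∫ s in (-(Real.pi / 2))..(Real.pi / 2), F s := by
    have := hper.intervalIntegral_add_eq 0 (-(Real.pi / 2))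
    rw [zero_add] at this
    rw [this, ← intervalIntegral.integral_add_adjacent_intervals (hi _ (Real.pi / 2)) (hi _ _),
      two_mul (∫ s in (-(Real.pi / 2))..(Real.pi / 2), F s)]
    congr 1
    have h := intervalIntegral.integral_comp_sub_left (a := -(Real.pi / 2)) (b := Real.pi / 2) F
      Real.pi
    rw [show Real.pi - Real.pi / 2 = Real.pi / 2 by ring,
      show Real.pi - -(Real.pi / 2) = -(Real.pi / 2) + 2 * Real.pi by ring] at h
    rw [← h]
    simp [hF, Real.sin_pi_sub]
  have h2 : ∫ s in (-(Real.pi / 2))..(Real.pi / 2), F s =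
      ∫ s in (-(Real.pi / 2))..(Real.pi / 2),
        ((Real.cos (x * Real.arcsin (b⁻¹ * Real.sin s)) : ℝ) : ℂ) := by
    have h := intervalIntegral.integral_comp_neg (a := -(Real.pi / 2)) (b := Real.pi / 2) F
    rw [neg_neg] at h
    have h3 : ∫ s in (-(Real.pi / 2))..(Real.pi / 2), (F s + F (-s)) =
        2 * ∫ s in (-(Real.pi / 2))..(Real.pi / 2), F s := by
      have i1 : Continuous fun s => F (-s) := hFc.comp continuous_neg
      rw [intervalIntegral.integral_add (hi _ _) (i1.intervalIntegrable _ _), h, two_mul]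
    have h4 : ∀ s, F s + F (-s) =
        2 * ((Real.cos (x * Real.arcsin (b⁻¹ * Real.sin s)) : ℝ) : ℂ) := by
      intro s
      simp only [hF, Real.sin_neg, mul_neg, Real.arcsin_neg]
      rw [Complex.ofReal_cos, Complex.two_cos, Complex.ofReal_neg, mul_comm Complex.I,
        mul_comm Complex.I, neg_mul]
    simp_rw [h4] at h3
    rw [intervalIntegral.integral_const_mul] at h3
    exact (mul_left_cancel₀ two_ne_zero h3).symm
  rw [charI_eq_integral_arcsin hb, h1, h2, intervalIntegral.integral_ofReal]
  have hpi : (Real.pi : ℂ) ≠ 0 := by exact_mod_cast Real.pi_ne_zero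
  push_cast
  field_simp

/-- The phase is odd and the cosine even, so `s ↦ -s` swaps the cutoff with its complement and both
halves contribute equally. -/
theorem integral_cos_eq_two_mul_cutoff (β r x : ℝ) :
    ∫ s in (-(Real.pi / 2))..(Real.pi / 2), Real.cos (x * Real.arcsin (r * Real.sin s)) =
      2 * ∫ s in (-(Real.pi / 2))..(Real.pi / 2), phaseCutoff β (Real.arcsin (r * Real.sin s)) *
        Real.cos (x * Real.arcsin (r * Real.sin s)) := by
  set F : ℝ → ℝ := fun s => phaseCutoff β (Real.arcsin (r * Real.sin s)) *
        Real.cos (x * Real.arcsin (r * Real.sin s)) with hF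
  have hFc : Continuous F := by
    have := Real.continuous_arcsin
    have := (contDiff_phaseCutoff β).continuous
    fun_prop
  have h := intervalIntegral.integral_comp_neg (a := -(Real.pi / 2)) (b := Real.pi / 2) F
  rw [neg_neg] at h
  rw [two_mul]
  nth_rewrite 1 [← h]
  have i1 : Continuous fun s => F (-s) := hFc.comp continuous_neg
  rw [← intervalIntegral.integral_add (i1.intervalIntegrable _ _)
    (hFc.intervalIntegrable _ _)]
  congr 1
  ext s
  simp only [hF, Real.sin_neg, mul_neg, Real.arcsin_neg, Real.cos_neg]
  rw [← add_mul, add_comm, phaseCutoff_add_neg, one_mul]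

/-! ### Passage to the exactly quadratic phase -/

theorem one_sub_sq_mul_sin {b β w : ℝ} (hβ : b * Real.sin β = 1) :
    1 - (b * Real.sin (β - w)) ^ 2 = b ^ 2 * (Real.sin (2 * β - w) * Real.sin w) := by
  -- With `y = β - w` this is `sin² β - sin² y = sin (β + y) sin (β - y)`, scaled by `b²`.
  have e1 : Real.sin (2 * β - w) = Real.sin (β + (β - w)) := by congr 1; ring
  have e2 : Real.sin w = Real.sin (β - (β - w)) := by congr 1; ring
  rw [e1, e2, Real.sin_add, Real.sin_sub β (β - w)]
  have h1 := Real.sin_sq_add_cos_sq β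
  have h2 := Real.sin_sq_add_cos_sq (β - w)
  have h3 : b ^ 2 * Real.sin β ^ 2 = 1 := by rw [← mul_pow, hβ, one_pow]
  linear_combination -h3 + b ^ 2 * Real.sin (β - w) ^ 2 * h1 - b ^ 2 * Real.sin β ^ 2 * h2

/-- Writing `sin (v²) = v² sinc (v²)` extracts a factor `v` from the root in the derivative of
`arcsin`; it cancels the `2v` of the chain rule. At `v = 0` the inner value is 1, where `arcsin` is
not differentiable, hence `0 < v`. -/
theorem hasDerivAt_phase_inverse {b β v : ℝ} (hb : 0 < b) (h0 : 0 < β) (h1 : β < Real.pi / 2)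
    (hβ : b * Real.sin β = 1) (hv : 0 < v) (hv2 : v ^ 2 < 2 * β) :
    HasDerivAt (fun v => Real.arcsin (b * Real.sin (β - v ^ 2))) (-phaseProfile β (v ^ 2)) v := by
  have hpos := sin_mul_sinc_pos (w := v ^ 2) h0 h1 ⟨by nlinarith [sq_nonneg v], hv2⟩
  have e : 1 - (b * Real.sin (β - v ^ 2)) ^ 2 =
      (b * v) ^ 2 * (Real.sin (2 * β - v ^ 2) * Real.sinc (v ^ 2)) := by
    rw [one_sub_sq_mul_sin hβ, ← Real.mul_sinc (v ^ 2)]; ring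
  have hlt : 0 < 1 - (b * Real.sin (β - v ^ 2)) ^ 2 := by rw [e]; positivity
  have hd : HasDerivAt (fun v => b * Real.sin (β - v ^ 2))
      (b * (Real.cos (β - v ^ 2) * -(2 * v))) v := by
    have := (((hasDerivAt_pow 2 v).const_sub β).sin).const_mul b
    simpa using this
  have := (Real.hasDerivAt_arcsin (x := b * Real.sin (β - v ^ 2))
    (by intro h; rw [h] at hlt; norm_num at hlt)
    (by intro h; rw [h] at hlt; norm_num at hlt)).comp v hd
  refine this.congr_deriv ?_
  rw [e, Real.sqrt_mul (by positivity), Real.sqrt_sq (by positivity), phaseProfile]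
  have := Real.sqrt_pos.2 hpos
  field_simp

theorem integral_cutoff_eq {b β : ℝ} (hb : 0 < b) (h0 : 0 < β) (h1 : β < Real.pi / 2)
    (hβ : b * Real.sin β = 1) (x : ℝ) :
    ∫ s in (-(Real.pi / 2))..(Real.pi / 2), phaseCutoff β (Real.arcsin (b⁻¹ * Real.sin s)) *
        Real.cos (x * Real.arcsin (b⁻¹ * Real.sin s)) =
      ∫ v in (0 : ℝ)..√(3 * β / 2), phaseAmplitude β v * Real.cos (x * (β - v ^ 2)) := by
  set F : ℝ → ℝ := fun s => phaseCutoff β (Real.arcsin (b⁻¹ * Real.sin s)) *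
        Real.cos (x * Real.arcsin (b⁻¹ * Real.sin s)) with hF
  have hFc : Continuous F := by
    have := Real.continuous_arcsin
    have := (contDiff_phaseCutoff β).continuous
    fun_prop
  -- At `v = V` the phase is `-β/2`, exactly where the cutoff reaches zero, so the range of `s`
  -- below `S V` contributes nothing.
  set V := √(3 * β / 2) with hV
  have hV0 : 0 < V := Real.sqrt_pos.2 (by linarith)
  have hV2 : V ^ 2 = 3 * β / 2 := Real.sq_sqrt (by linarith)
  set S : ℝ → ℝ := fun v => Real.arcsin (b * Real.sin (β - v ^ 2)) with hS
  have hSc : Continuous S := by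
    have := Real.continuous_arcsin
    fun_prop
  have hle : ∀ v ∈ Set.Icc 0 V, v ^ 2 ≤ 3 * β / 2 := fun v hv => by
    rw [← hV2]; exact pow_le_pow_left₀ hv.1 hv.2 2
  have hsinS : ∀ v ∈ Set.Icc 0 V, b⁻¹ * Real.sin (S v) = Real.sin (β - v ^ 2) := by
    intro v hv
    have hv2 := hle v hv
    have hpos : 0 ≤ Real.sin (2 * β - v ^ 2) * Real.sin (v ^ 2) := by
      rw [← Real.mul_sinc (v ^ 2)]
      have := sin_mul_sinc_pos (w := v ^ 2) h0 h1 ⟨by nlinarith [sq_nonneg v], by linarith⟩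
      rw [mul_left_comm]
      exact mul_nonneg (sq_nonneg v) this.le
    have e := one_sub_sq_mul_sin (w := v ^ 2) hβ
    have : (b * Real.sin (β - v ^ 2)) ^ 2 ≤ 1 := by
      have : 0 ≤ b ^ 2 * (Real.sin (2 * β - v ^ 2) * Real.sin (v ^ 2)) := by positivity
      linarith
    have := abs_le.1 ((sq_le_one_iff_abs_le_one _).1 this)
    rw [hS]
    simp only
    rw [Real.sin_arcsin this.1 this.2]
    field_simp
  have hψS : ∀ v ∈ Set.Icc 0 V, Real.arcsin (b⁻¹ * Real.sin (S v)) = β - v ^ 2 := by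
    intro v hv
    have hv2 := hle v hv
    rw [hsinS v hv, Real.arcsin_sin (by linarith) (by nlinarith [sq_nonneg v])]
  have hFS : ∀ v ∈ Set.Icc 0 V, F (S v) =
      phaseCutoff β (β - v ^ 2) * Real.cos (x * (β - v ^ 2)) := by
    intro v hv
    simp only [hF]
    rw [hψS v hv]
  have hS0 : S 0 = Real.pi / 2 := by simp [hS, hβ]
  have hVm : V ∈ Set.Icc 0 V := ⟨hV0.le, le_rfl⟩
  have hzero : ∫ s in (-(Real.pi / 2))..S V, F s = 0 := by
    refine intervalIntegral.integral_zero_ae (Eventually.of_forall fun s hs => ?_)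
    rw [Set.uIoc_of_le (Real.neg_pi_div_two_le_arcsin _)] at hs
    have hsS : Real.sin s ≤ Real.sin (S V) :=
      Real.sin_le_sin_of_le_of_le_pi_div_two hs.1.le (Real.arcsin_le_pi_div_two _) hs.2
    have : Real.arcsin (b⁻¹ * Real.sin s) ≤ -β / 2 := by
      calc Real.arcsin (b⁻¹ * Real.sin s) ≤ Real.arcsin (b⁻¹ * Real.sin (S V)) :=
            Real.monotone_arcsin (by gcongr)
        _ = -β / 2 := by rw [hψS V hVm, hV2]; ring
    simp only [hF]
    rw [phaseCutoff_eq_zero h0 this, zero_mul]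
  -- This form of substitution asks for the derivative only in the open interval, avoiding `v = 0`;
  -- the derivative's formula is still continuous up to the endpoints.
  have hsub := intervalIntegral.integral_deriv_smul_comp'' (a := 0) (b := V) (f := S)
    (f' := fun v => -phaseProfile β (v ^ 2)) (g := F) hSc.continuousOn
    (by
      intro v hv
      rw [min_eq_left hV0.le, max_eq_right hV0.le] at hv
      have := hle v ⟨hv.1.le, hv.2.le⟩
      exact (hasDerivAt_phase_inverse hb h0 h1 hβ hv.1 (by linarith)).hasDerivWithinAt)
    (by
      refine ((contDiffOn_phaseProfile h0 h1).continuousOn.comp (by fun_prop) ?_).neg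
      intro v hv
      rw [Set.uIcc_of_le hV0.le] at hv
      have := hle v hv
      exact ⟨by nlinarith [sq_nonneg v], by linarith⟩)
    hFc.continuousOn
  rw [← intervalIntegral.integral_add_adjacent_intervals
    (hFc.intervalIntegrable _ (S V)) (hFc.intervalIntegrable _ _), hzero, zero_add, ← hS0,
    intervalIntegral.integral_symm, ← hsub, ← intervalIntegral.integral_neg]
  refine intervalIntegral.integral_congr fun v hv => ?_
  rw [Set.uIcc_of_le hV0.le] at hv
  simp only [Function.comp, smul_eq_mul]
  rw [hFS v hv, phaseAmplitude]
  ring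

/-- The integrand is even in `v`, so passing to the whole line removes the endpoint at 0, and with
it all odd-order terms. -/
theorem integral_phaseAmplitude_mul_cos {β : ℝ} (h0 : 0 < β) (x : ℝ) :
    ∫ v : ℝ, phaseAmplitude β v * Real.cos (x * (β - v ^ 2)) =
      2 * ∫ v in (0 : ℝ)..√(3 * β / 2), phaseAmplitude β v * Real.cos (x * (β - v ^ 2)) := by
  have h := integral_comp_abs (f := fun v => phaseAmplitude β v * Real.cos (x * (β - v ^ 2)))
  simp only [phaseAmplitude, sq_abs] at h
  simp only [phaseAmplitude]
  rw [h, intervalIntegral.integral_of_le (Real.sqrt_nonneg _)]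
  congr 1
  refine setIntegral_eq_of_subset_of_forall_sdiff_eq_zero measurableSet_Ioi
    Set.Ioc_subset_Ioi_self fun v hv => ?_
  have hv' : √(3 * β / 2) < v := by
    by_contra! hc
    exact hv.2 ⟨hv.1, hc⟩
  have := phaseAmplitude_eq_zero (v := v) h0 (Real.sqrt_le_left hv.1.le |>.1 hv'.le)
  rw [phaseAmplitude] at this
  rw [this, zero_mul]

/-- `charI` as an integral with an exactly quadratic phase. -/
theorem charI_eq_integral_phaseAmplitude {b β : ℝ} (hb : 1 < b) (h0 : 0 < β)
    (h1 : β < Real.pi / 2) (hβ : b * Real.sin β = 1) (x : ℝ) :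
    charI b x = ((1 / Real.pi *
      ∫ v : ℝ, phaseAmplitude β v * Real.cos (x * (β - v ^ 2)) : ℝ) : ℂ) := by
  rw [charI_eq_integral_cos hb, integral_cos_eq_two_mul_cutoff β,
    integral_cutoff_eq (by linarith) h0 h1 hβ, ← integral_phaseAmplitude_mul_cos h0]

/-! ### The expansion to all orders -/

theorem iteratedDeriv_ofReal_comp_of_contDiff {f : ℝ → ℝ} (hf : ContDiff ℝ ∞ f) (n : ℕ) :
    iteratedDeriv n (fun v => (f v : ℂ)) = fun v => ((iteratedDeriv n f v : ℝ) : ℂ) := by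
  induction n with
  | zero => simp
  | succ n ih =>
    ext v
    rw [iteratedDeriv_succ, ih, iteratedDeriv_succ]
    have hd : DifferentiableAt ℝ (iteratedDeriv n f) v :=
      (hf.differentiable_iteratedDeriv n (by exact_mod_cast WithTop.coe_lt_top _)).differentiableAt
    exact hd.hasDerivAt.ofReal_comp.deriv

/-- The phase amplitude as a Schwartz function. -/
noncomputable def phaseAmplitudeSchwartz {β : ℝ} (h0 : 0 < β) (h1 : β < Real.pi / 2) : 𝓢(ℝ, ℂ) :=
  HasCompactSupport.toSchwartzMap (f := fun v => (phaseAmplitude β v : ℂ))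
    ((hasCompactSupport_phaseAmplitude h0).comp_left (g := Complex.ofReal) Complex.ofReal_zero)
    (Complex.ofRealCLM.contDiff.comp (contDiff_phaseAmplitude h0 h1))

theorem phaseAmplitudeSchwartz_apply {β : ℝ} (h0 : 0 < β) (h1 : β < Real.pi / 2) (v : ℝ) :
    phaseAmplitudeSchwartz h0 h1 v = (phaseAmplitude β v : ℂ) := rfl

theorem integral_phaseAmplitude_eq_re {β : ℝ} (h0 : 0 < β) (h1 : β < Real.pi / 2) (x : ℝ) :
    ∫ v : ℝ, phaseAmplitude β v * Real.cos (x * (β - v ^ 2)) =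
      (Complex.exp (Complex.I * (x * β)) * ∫ v : ℝ, Complex.exp (-(Complex.I * x * v ^ 2)) *
        phaseAmplitudeSchwartz h0 h1 v).re := by
  rw [← integral_const_mul, ← Complex.reCLM_apply, ← ContinuousLinearMap.integral_comp_comm]
  · congr 1
    ext v
    rw [← mul_assoc, ← Complex.exp_add, phaseAmplitudeSchwartz_apply, Complex.reCLM_apply,
      Complex.re_mul_ofReal,
      show Complex.I * (x * β) + -(Complex.I * x * v ^ 2) =
        ((x * (β - v ^ 2) : ℝ) : ℂ) * Complex.I by push_cast; ring,
      Complex.exp_ofReal_mul_I_re, mul_comm]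
  · refine Integrable.const_mul ?_ _
    refine (phaseAmplitudeSchwartz h0 h1).integrable.norm.mono (by fun_prop)
      (Eventually.of_forall fun v => ?_)
    rw [norm_mul, show -(Complex.I * x * v ^ 2) = Complex.I * ((-(x * v ^ 2) : ℝ) : ℂ) by
      push_cast; ring, Complex.norm_exp_I_mul_ofReal]
    simp

/-- The coefficients of the asymptotic expansion of `charI`. -/
noncomputable def charICoeff (β : ℝ) (k : ℕ) : ℝ :=
  iteratedDeriv (2 * k) (phaseAmplitude β) 0 / (√Real.pi * (4 ^ k * k.factorial))

/-- `(-i)^k = e^{-ikπ/2}` joins `e^{ixβ}` and `e^{-iπ/4}` in a single phase whose real part is the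
cosine; `√π / π` becomes `1 / √π`. -/
theorem re_expansion_term (x β D X : ℝ) (k : ℕ) :
    1 / Real.pi * (Complex.exp (Complex.I * (x * β)) * (√Real.pi *
      Complex.exp (-(Complex.I * (Real.pi / 4))) * ((-Complex.I) ^ k * D / (4 ^ k * k.factorial)) *
        (X : ℂ))).re =
      D / (√Real.pi * (4 ^ k * k.factorial)) *
        Real.cos (x * β - Real.pi / 4 - k * (Real.pi / 2)) * X := by
  have hI : (-Complex.I) ^ k = Complex.exp (-(Complex.I * (k * (Real.pi / 2)))) := by
    rw [← Complex.exp_neg_pi_div_two_mul_I, ← Complex.exp_nat_mul]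
    congr 1; ring
  have : Complex.exp (Complex.I * (x * β)) * (√Real.pi *
      Complex.exp (-(Complex.I * (Real.pi / 4))) * ((-Complex.I) ^ k * D / (4 ^ k * k.factorial)) *
        (X : ℂ)) = ((√Real.pi * D / (4 ^ k * k.factorial) * X : ℝ) : ℂ) *
        Complex.exp (((x * β - Real.pi / 4 - k * (Real.pi / 2) : ℝ) : ℂ) * Complex.I) := by
    rw [hI, show ((x * β - Real.pi / 4 - k * (Real.pi / 2) : ℝ) : ℂ) * Complex.I =
      Complex.I * (x * β) + -(Complex.I * (Real.pi / 4)) + -(Complex.I * (k * (Real.pi / 2))) by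
        push_cast; ring, Complex.exp_add, Complex.exp_add]
    push_cast
    ring
  rw [this, Complex.re_ofReal_mul, Complex.exp_ofReal_mul_I_re]
  have hpi := Real.pi_pos
  have hs : √Real.pi ^ 2 = Real.pi := Real.sq_sqrt hpi.le
  have hs0 : √Real.pi ≠ 0 := (Real.sqrt_pos.2 hpi).ne'
  nth_rewrite 1 [← hs]
  field_simp

/-- Taking real parts after multiplying by the unimodular `e^{ixβ}` cannot enlarge the Fresnel
error, so only the factor `1/π` is lost. -/
theorem charI_expansion {b β : ℝ} (hb : 1 < b) (h0 : 0 < β) (h1 : β < Real.pi / 2)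
    (hβ : b * Real.sin β = 1) (N : ℕ) :
    (fun x : ℝ => charI b x -
          ((∑ k ∈ Finset.range N,
            charICoeff β k * Real.cos (x * β - Real.pi / 4 - k * (Real.pi / 2)) *
              x ^ (-((k : ℝ) + 1 / 2)) : ℝ) : ℂ))
          =O[atTop] (fun x : ℝ => x ^ (-((N : ℝ) + 1 / 2))) := by
  refine IsBigO.trans (IsBigO.of_bound (1 / Real.pi) (Eventually.of_forall fun x => ?_))
    (fresnel_expansion (phaseAmplitudeSchwartz h0 h1) N)
  set J := ∫ v : ℝ, Complex.exp (-(Complex.I * x * v ^ 2)) * phaseAmplitudeSchwartz h0 h1 v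
  have hD : ∀ k : ℕ, iteratedDeriv (2 * k) (phaseAmplitudeSchwartz h0 h1) 0 =
      ((iteratedDeriv (2 * k) (phaseAmplitude β) 0 : ℝ) : ℂ) := fun k =>
    congrFun (iteratedDeriv_ofReal_comp_of_contDiff (contDiff_phaseAmplitude h0 h1) (2 * k)) 0
  simp_rw [hD]
  set T := ∑ k ∈ Finset.range N, √Real.pi * Complex.exp (-(Complex.I * (Real.pi / 4))) *
    ((-Complex.I) ^ k * ((iteratedDeriv (2 * k) (phaseAmplitude β) 0 : ℝ) : ℂ) /
      (4 ^ k * k.factorial)) * ((x ^ (-((k : ℝ) + 1 / 2)) : ℝ) : ℂ) with hT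
  have hsum : ∑ k ∈ Finset.range N,
      charICoeff β k * Real.cos (x * β - Real.pi / 4 - k * (Real.pi / 2)) *
        x ^ (-((k : ℝ) + 1 / 2)) =
      1 / Real.pi * (Complex.exp (Complex.I * (x * β)) * T).re := by
    rw [hT, Finset.mul_sum, Complex.re_sum, Finset.mul_sum]
    exact Finset.sum_congr rfl fun k _ => (re_expansion_term _ _ _ _ _).symm
  rw [charI_eq_integral_phaseAmplitude hb h0 h1 hβ, integral_phaseAmplitude_eq_re h0 h1, hsum,
    ← Complex.ofReal_sub, ← mul_sub, ← Complex.sub_re, ← mul_sub, Complex.norm_real, norm_mul,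
    Real.norm_of_nonneg (by positivity : 0 ≤ 1 / Real.pi)]
  gcongr
  refine (Complex.abs_re_le_norm _).trans_eq ?_
  rw [norm_mul, show Complex.I * ((x : ℂ) * β) = Complex.I * ((x * β : ℝ) : ℂ) by push_cast; rfl,
    Complex.norm_exp_I_mul_ofReal, one_mul]

/-! ### Explicit coefficients -/

/-- The Taylor coefficients of the profile in terms of `b` and `t = (b² - 1)^{1/4}`. -/
theorem phaseProfile_derivs {b β t : ℝ} (hb : 1 < b) (h0 : 0 < β) (h1 : β < Real.pi / 2)
    (hβ : b * Real.sin β = 1) (ht : 0 < t) (htb : t ^ 4 = b ^ 2 - 1) :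
    phaseProfile β 0 = √2 * t ∧
    deriv (phaseProfile β) 0 = √2 * t * ((b ^ 2 + 2) / (4 * t ^ 2)) ∧
    deriv (deriv (phaseProfile β)) 0 =
      √2 * t * ((9 * b ^ 4 - 28 * b ^ 2 + 4) / (48 * t ^ 4)) := by
  have hb0 : 0 < b := by linarith
  have hs : Real.sin β = 1 / b := by field_simp; linarith
  have hcpos : 0 < Real.cos β := Real.cos_pos_of_mem_Ioo ⟨by linarith, h1⟩
  have hc : Real.cos β = t ^ 2 / b := by
    refine (pow_left_inj₀ hcpos.le (by positivity) two_ne_zero).1 ?_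
    have := Real.sin_sq_add_cos_sq β
    rw [hs] at this
    rw [div_pow, ← pow_mul, htb]
    field_simp at this ⊢
    linarith
  have hs2 : Real.sin (2 * β) = 2 * t ^ 2 / b ^ 2 := by
    rw [Real.sin_two_mul, hs, hc]; field_simp
  have hc2 : Real.cos (2 * β) = (b ^ 2 - 2) / b ^ 2 := by
    rw [Real.cos_two_mul, hc, div_pow, ← pow_mul, htb]; field_simp; ring
  have hr2 : √2 ^ 2 = (2 : ℝ) := Real.sq_sqrt (by norm_num)
  have hr0 : 0 < √(2 : ℝ) := by positivity
  have hp0 : phaseProfile β 0 = √2 * t := by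
    have e : √(2 * t ^ 2 / b ^ 2) = √2 * t / b := by
      rw [Real.sqrt_div' _ (by positivity), Real.sqrt_mul (by norm_num), Real.sqrt_sq ht.le,
        Real.sqrt_sq hb0.le]
    rw [phaseProfile, sub_zero, sub_zero, Real.sinc_zero, mul_one, hs2, e, hc]
    field_simp
    linarith
  obtain ⟨r1, r2⟩ := phaseProfile_relations h0 h1
  rw [hp0, hs2, hc2, hc, hs] at r1 r2
  -- Dividing the derivatives by the value `√2 t` clears `√2` from the relations, leaving rational
  -- identities in `b` and `t` tied by `t⁴ = b² - 1`.
  obtain ⟨u, hu⟩ : ∃ u, deriv (phaseProfile β) 0 = √2 * t * u :=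
    ⟨deriv (phaseProfile β) 0 / (√2 * t), by field_simp⟩
  obtain ⟨w, hw⟩ : ∃ w, deriv (deriv (phaseProfile β)) 0 = √2 * t * w :=
    ⟨deriv (deriv (phaseProfile β)) 0 / (√2 * t), by field_simp⟩
  rw [hu] at r1 r2
  rw [hw] at r2
  have s1 : 2 * (√2 * t) * (√2 * t * u) = 4 * t ^ 2 * u := by
    linear_combination 2 * t ^ 2 * u * hr2
  have s2 : (√2 * t) ^ 2 = 2 * t ^ 2 := by rw [mul_pow, hr2]
  have s3 : 2 * (√2 * t * u) ^ 2 + 2 * (√2 * t) * (√2 * t * w) = 4 * t ^ 2 * (u ^ 2 + w) := by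
    linear_combination (2 * t ^ 2 * u ^ 2 + 2 * t ^ 2 * w) * hr2
  have s4 : 4 * (√2 * t) * (√2 * t * u) = 8 * t ^ 2 * u := by
    linear_combination 4 * t ^ 2 * u * hr2
  rw [s1, s2] at r1
  rw [s3, s4, s2] at r2
  have hu' : u = (b ^ 2 + 2) / (4 * t ^ 2) := by
    field_simp at r1 ⊢
    linarith
  have hw' : w = (9 * b ^ 4 - 28 * b ^ 2 + 4) / (48 * t ^ 4) := by
    rw [hu'] at r2
    field_simp at r2 ⊢
    linear_combination (1 / 2) * r2 - 16 * htb
  exact ⟨hp0, by rw [hu, hu'], by rw [hw, hw']⟩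

theorem charICoeff_values {b β t : ℝ} (hb : 1 < b) (h0 : 0 < β) (h1 : β < Real.pi / 2)
    (hβ : b * Real.sin β = 1) (ht : 0 < t) (htb : t ^ 4 = b ^ 2 - 1) :
    charICoeff β 0 = 2 / √(2 * Real.pi) * t ∧
    charICoeff β 1 = (b ^ 2 + 2) / (4 * √(2 * Real.pi)) * t⁻¹ ∧
    charICoeff β 2 = (9 * b ^ 4 - 28 * b ^ 2 + 4) / (64 * √(2 * Real.pi)) * (t ^ 3)⁻¹ := by
  obtain ⟨d0, d1, d2⟩ := iteratedDeriv_phaseAmplitude_zero h0 h1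
  obtain ⟨p0, p1, p2⟩ := phaseProfile_derivs hb h0 h1 hβ ht htb
  have hpi : 0 < √Real.pi := Real.sqrt_pos.2 Real.pi_pos
  have hr2 : √2 ^ 2 = (2 : ℝ) := Real.sq_sqrt (by norm_num)
  have hr0 : 0 < √(2 : ℝ) := by positivity
  rw [Real.sqrt_mul (by norm_num)]
  refine ⟨?_, ?_, ?_⟩
  · rw [charICoeff, mul_zero, d0, p0]
    field_simp
    simp [hr2]
  · rw [charICoeff, mul_one, d1, p1]
    field_simp
    rw [hr2]
    simp
    ring
  · rw [charICoeff, show 2 * 2 = 4 from rfl, d2, p2]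
    field_simp
    rw [hr2]
    norm_num [Nat.factorial]
    ring

theorem mainTheorem5 (b : ℝ) (hb : 1 < b) (β : ℝ) (hβ : β = Real.arcsin (1 / b)) :
    (∃ a : ℕ → ℝ,
      a 0 = 2 / Real.sqrt (2 * Real.pi) * (b ^ 2 - 1) ^ (1 / 4 : ℝ) ∧
      a 1 = (b ^ 2 + 2) / (4 * Real.sqrt (2 * Real.pi)) * (b ^ 2 - 1) ^ (-(1 / 4) : ℝ) ∧
      a 2 = (9 * b ^ 4 - 28 * b ^ 2 + 4) / (64 * Real.sqrt (2 * Real.pi)) *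
        (b ^ 2 - 1) ^ (-(3 / 4) : ℝ) ∧
      ∀ N : ℕ,
        (fun x : ℝ => charI b x -
          ((∑ k ∈ Finset.range N,
            a k * Real.cos (x * β - Real.pi / 4 - k * (Real.pi / 2)) *
              x ^ (-((k : ℝ) + 1 / 2)) : ℝ) : ℂ))
          =O[Filter.atTop] (fun x : ℝ => x ^ (-((N : ℝ) + 1 / 2)))) ∧
    (fun x : ℝ => charI b x -
      ((2 / Real.sqrt (2 * Real.pi) * ((b ^ 2 - 1) ^ (1 / 4 : ℝ) / x ^ (1 / 2 : ℝ)) *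
            Real.cos (x * β - Real.pi / 4)
        + (b ^ 2 + 2) / (4 * Real.sqrt (2 * Real.pi)) *
            ((b ^ 2 - 1) ^ (-(1 / 4) : ℝ) / x ^ (3 / 2 : ℝ)) *
            Real.sin (x * β - Real.pi / 4)
        - (9 * b ^ 4 - 28 * b ^ 2 + 4) / (64 * Real.sqrt (2 * Real.pi)) *
            ((b ^ 2 - 1) ^ (-(3 / 4) : ℝ) / x ^ (5 / 2 : ℝ)) *
            Real.cos (x * β - Real.pi / 4) : ℝ) : ℂ))
      =O[Filter.atTop] (fun x : ℝ => 1 / x ^ (7 / 2 : ℝ)) := by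
  have hb0 : 0 < b := by linarith
  have hr1 : 1 / b < 1 := by rw [div_lt_one hb0]; exact hb
  have h0 : 0 < β := by rw [hβ]; exact Real.arcsin_pos.2 (by positivity)
  have h1 : β < Real.pi / 2 := by rw [hβ]; exact Real.arcsin_lt_pi_div_two.2 hr1
  have hsin : b * Real.sin β = 1 := by
    have : (0 : ℝ) < 1 / b := by positivity
    rw [hβ, Real.sin_arcsin (by linarith) hr1.le]
    field_simp
  have hd : 0 < b ^ 2 - 1 := by nlinarith
  set t : ℝ := (b ^ 2 - 1) ^ (1 / 4 : ℝ) with ht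
  have ht0 : 0 < t := Real.rpow_pos_of_pos hd _
  have htb : t ^ 4 = b ^ 2 - 1 := by
    rw [ht, ← Real.rpow_natCast, ← Real.rpow_mul hd.le]
    norm_num
  have ht1 : (b ^ 2 - 1) ^ (-(1 / 4) : ℝ) = t⁻¹ := by rw [Real.rpow_neg hd.le]
  have ht3 : (b ^ 2 - 1) ^ (-(3 / 4) : ℝ) = (t ^ 3)⁻¹ := by
    rw [Real.rpow_neg hd.le, ht, ← Real.rpow_natCast _ 3, ← Real.rpow_mul hd.le]
    norm_num
  obtain ⟨a0, a1, a2⟩ := charICoeff_values hb h0 h1 hsin ht0 htb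
  have hexp := charI_expansion hb h0 h1 hsin
  rw [ht1, ht3]
  refine ⟨⟨charICoeff β, a0, a1, a2, hexp⟩, ?_⟩
  refine (hexp 3).congr' ?_ ?_
  · filter_upwards [eventually_gt_atTop 0] with x hx
    have c1 : Real.cos (x * β - Real.pi / 4 - 1 * (Real.pi / 2)) =
        Real.sin (x * β - Real.pi / 4) := by
      rw [one_mul, Real.cos_sub_pi_div_two]
    have c2 : Real.cos (x * β - Real.pi / 4 - 2 * (Real.pi / 2)) =
        -Real.cos (x * β - Real.pi / 4) := by
      rw [mul_div_cancel₀ _ two_ne_zero, Real.cos_sub_pi]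
    have x1 : -((1 : ℝ) + 1 / 2) = -(3 / 2) := by norm_num
    have x2 : -((2 : ℝ) + 1 / 2) = -(5 / 2) := by norm_num
    rw [Finset.sum_range_succ, Finset.sum_range_succ, Finset.sum_range_one, a0, a1, a2]
    simp only [Nat.cast_zero, Nat.cast_one, Nat.cast_ofNat]
    rw [c1, c2, x1, x2, zero_mul, sub_zero, zero_add, Real.rpow_neg hx.le, Real.rpow_neg hx.le,
      Real.rpow_neg hx.le]
    congr 2
    ring
  · filter_upwards [eventually_gt_atTop 0] with x hx
    rw [one_div (x ^ _), ← Real.rpow_neg hx.le]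
    norm_num
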